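/- Let $0<\alpha<1$ and $0<c\le\lambda_N$. For $k\ge 1$ let $\vartheta_1,\dots,\vartheta_k\in(-1,1)$ and $w_1,\dots,w_k$ be the nodes and weights of the $k$-point Gauss--Jacobi quadrature rule on $(-1,1)$ for the weight $\omega(t)=(1-t)^{-\alpha}(1+t)^{\alpha-1}$, and put $$R_{k-1,k}(x)=\frac{2\sin(\alpha\pi)}{\pi}\sum_{j=1}^{k}\frac{w_j}{1+\vartheta_j}\Bigl(\frac{1-\vartheta_j}{1+\vartheta_j}+x\Bigr)^{-1},$$ so that $\tau^{-\alpha}R_{k-1,k}(L/\tau)$ is the Gauss--Jacobi approximation of $L^{-\alpha}$ obtained from the substitution $\rho^{1/(1-\alpha)}=\tau\frac{1-t}{1+t}$ in $L^{-\alpha}=\frac{\sin(\alpha\pi)}{(1-\alpha)\pi}\int_0^\infty(\rho^{1/(1-\alpha)}I+L)^{-1}\,d\rho$. Set $$\tau_k=\left(-\frac{\alpha\lambda_N^{1/2}}{8k}\ln\frac{\lambda_N}{c}+\sqrt{\Bigl(\frac{\alpha\lambda_N^{1/2}}{8k}\ln\frac{\lambda_N}{c}\Bigr)^2+(c\lambda_N)^{1/2}}\right)^{2},$$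 and let $\overline\lambda(k)=\dfrac{\bigl(k+\sqrt{k^2+\alpha^2}\bigr)^2}{\alpha^2}\,\tau_k$, which is the point of $[\tau_k,\infty)$ at which $\lambda\mapsto\left(\frac{\lambda}{\tau_k}\right)^{-\alpha}\left[\frac{\lambda^{1/2}-\tau_k^{1/2}}{\lambda^{1/2}+\tau_k^{1/2}}\right]^{2k}$ attains its maximum. Then there is a constant $C$, depending only on $\alpha$, $c$ and $\lambda_N$, with the following property. Let $\overline k\ge1$ be such that $\overline\lambda(k)>\lambda_N$ for every $k\ge\overline k$. Then for every self-adjoint operator $L_N$ on a finite-dimensional (real or complex) inner product space with spectrum contained in $[c,\lambda_N]$, and for every $k\ge\overline k$, $$\left\|L_N^{-\alpha}-\tau_k^{-\alpha}R_{k-1,k}\!\left(\frac{L_N}{\tau_k}\right)\right\|\le 2\sin(\alpha\pi)\,(c\lambda_N)^{-\alpha/2}\exp\!\left(-4k\Bigl(\frac{c}{\lambda_N}\Bigr)^{1/4}\right)\left(1+\frac{C}{k}\right),$$ where $\|\cdot\|$ is the operator norm. -/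

import Mathlib

open scoped BigOperators

noncomputable section

namespace FracPow

/-- The negative (fractional) powers `L ^ (-α) u = ∑ₛ μₛ ^ (-α) ⟪φₛ, u⟫ φₛ` of a self-adjoint operator on a
finite-dimensional inner product space, where the `φₛ` are an orthonormal basis of eigenvectors of `L` and the `μₛ`
are the corresponding (real) eigenvalues, counted with multiplicity. -/
def negPow {𝕜 E : Type*} [RCLike 𝕜] [NormedAddCommGroup E] [InnerProductSpace 𝕜 E] [FiniteDimensional 𝕜 E]
    (L : E →L[𝕜] E) (hL : (L : E →ₗ[𝕜] E).IsSymmetric) (α : ℝ) : E →L[𝕜] E :=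
  ∑ s : Fin (Module.finrank 𝕜 E),
    (((hL.eigenvalues rfl s) ^ (-α) : ℝ) : 𝕜) •
      InnerProductSpace.rankOne 𝕜 (hL.eigenvectorBasis rfl s) (hL.eigenvectorBasis rfl s)

/-- The Jacobi polynomial `P_k^{(a,b)}`
`= ∑ₛ binom (k+a) (k-s) * binom (k+b) s * ((x-1)/2)^s * ((x+1)/2)^(k-s)`. -/
def jacobiPoly (a b : ℝ) (k : ℕ) : Polynomial ℝ :=
  ∑ s ∈ Finset.range (k + 1),
    Polynomial.C (Ring.choose ((k : ℝ) + a) (k - s) * Ring.choose ((k : ℝ) + b) s) *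
      (Polynomial.C (1 / 2) * (Polynomial.X - 1)) ^ s *
      (Polynomial.C (1 / 2) * (Polynomial.X + 1)) ^ (k - s)

/-- The Jacobi weight `ω(t) = (1-t)^(-α) (1+t)^(α-1)` on `(-1,1)`. -/
def jacobiWeight (α t : ℝ) : ℝ := (1 - t) ^ (-α) * (1 + t) ^ (α - 1)

/-- The nodes `ϑ_1, …, ϑ_k` of the `k`-point Gauss-Jacobi rule for the weight `ω`: the zeros of `P_k^{(-α,α-1)}`. -/
def gaussNodes (α : ℝ) (k : ℕ) : Finset ℝ := (jacobiPoly (-α) (α - 1) k).roots.toFinset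

/-- The weight of the `k`-point Gauss-Jacobi rule at the node `ϑ`: the integral against `ω` of the Lagrange basis
polynomial that is `1` at `ϑ` and `0` at the other nodes. -/
def gaussWeight (α : ℝ) (k : ℕ) (ϑ : ℝ) : ℝ :=
  ∫ t in (-1 : ℝ)..1, (Lagrange.basis (gaussNodes α k) id ϑ).eval t * jacobiWeight α t

/-- The rational function `R_{k-1,k}` of an operator `A`,
`R(A) = ∑_j (2 sin(απ)/π) (w_j/(1+ϑ_j)) ((1-ϑ_j)/(1+ϑ_j) I + A)⁻¹`. -/
def ratApprox {𝕜 E : Type*} [RCLike 𝕜] [NormedAddCommGroup E] [NormedSpace 𝕜 E]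
    (α : ℝ) (k : ℕ) (A : E →L[𝕜] E) : E →L[𝕜] E :=
  ∑ ϑ ∈ gaussNodes α k,
    ((2 * Real.sin (α * Real.pi) / Real.pi * (gaussWeight α k ϑ / (1 + ϑ)) : ℝ) : 𝕜) •
      Ring.inverse ((((1 - ϑ) / (1 + ϑ) : ℝ) : 𝕜) • (1 : E →L[𝕜] E) + A)

/-- With `γ_j = (2 sin(απ) τ^(1-α)/π) w_j/(1+ϑ_j)` and `η_j = τ (1-ϑ_j)/(1+ϑ_j)`, one has
`τ^(-α) R_{k-1,k}(L/τ) = ∑_j γ_j (η_j I + L)⁻¹`. This is the `k`-point Gauss-Jacobi rule applied to the integral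
representation `L^(-α) = (2 sin(απ) τ^(1-α)/π) ∫ ω(t) (1+t)⁻¹ (τ (1-t)/(1+t) I + L)⁻¹ dt`. -/
theorem smul_ratApprox_eq {𝕜 E : Type*} [RCLike 𝕜] [NormedAddCommGroup E] [NormedSpace 𝕜 E]
    (α : ℝ) (k : ℕ) {τ : ℝ} (hτ : 0 < τ) (L : E →L[𝕜] E) :
    ((τ ^ (-α) : ℝ) : 𝕜) • ratApprox α k (((τ⁻¹ : ℝ) : 𝕜) • L) =
      ∑ ϑ ∈ gaussNodes α k,
        ((2 * Real.sin (α * Real.pi) * τ ^ (1 - α) / Real.pi * (gaussWeight α k ϑ / (1 + ϑ)) : ℝ) : 𝕜) •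
          Ring.inverse (((τ * (1 - ϑ) / (1 + ϑ) : ℝ) : 𝕜) • (1 : E →L[𝕜] E) + L) := by
  have hτ' : ((τ : ℝ) : 𝕜) ≠ 0 := by exact_mod_cast hτ.ne'
  have key : ∀ B : E →L[𝕜] E, Ring.inverse (((τ⁻¹ : ℝ) : 𝕜) • B) = (τ : 𝕜) • Ring.inverse B := by
    intro B
    have hu : IsUnit (((τ⁻¹ : ℝ) : 𝕜) • B) ↔ IsUnit B := by

      have h2 := isUnit_smul_iff (Units.mk0 (((τ⁻¹ : ℝ) : 𝕜)) (by push_cast; exact inv_ne_zero hτ')) B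
      simpa [Units.smul_def] using h2
    by_cases hB : IsUnit B
    · have h1 : (((τ⁻¹ : ℝ) : 𝕜) • B) * ((τ : 𝕜) • Ring.inverse B) = 1 := by
        rw [smul_mul_smul_comm, Ring.mul_inverse_cancel B hB]
        push_cast
        rw [inv_mul_cancel₀ hτ', one_smul]
      calc Ring.inverse (((τ⁻¹ : ℝ) : 𝕜) • B)
          = Ring.inverse (((τ⁻¹ : ℝ) : 𝕜) • B) *
              ((((τ⁻¹ : ℝ) : 𝕜) • B) * ((τ : 𝕜) • Ring.inverse B)) := by rw [h1, mul_one]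
        _ = _ := by rw [← mul_assoc, Ring.inverse_mul_cancel _ (hu.2 hB), one_mul]
    · rw [Ring.inverse_non_unit _ hB, Ring.inverse_non_unit _ (fun h => hB (hu.1 h)), smul_zero]
  unfold ratApprox
  rw [Finset.smul_sum]
  refine Finset.sum_congr rfl fun ϑ _ => ?_
  have hA : (((1 - ϑ) / (1 + ϑ) : ℝ) : 𝕜) • (1 : E →L[𝕜] E) + ((τ⁻¹ : ℝ) : 𝕜) • L =
      ((τ⁻¹ : ℝ) : 𝕜) • (((τ * (1 - ϑ) / (1 + ϑ) : ℝ) : 𝕜) • (1 : E →L[𝕜] E) + L) := by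
    rw [smul_add, smul_smul, ← RCLike.ofReal_mul]
    congr 4
    field_simp
  rw [hA, key, smul_smul, smul_smul, ← RCLike.ofReal_mul, ← RCLike.ofReal_mul]
  congr 2
  rw [sub_eq_add_neg, Real.rpow_add hτ, Real.rpow_one]
  ring

/-- `f(l, τ) = (l/τ)^(-α) ((√l - √τ)/(√l + √τ))^(2k)`, the `τ`-dependent factor of the truncation error. -/
def errFactor (α : ℝ) (k : ℕ) (l τ : ℝ) : ℝ :=
  (l / τ) ^ (-α) * ((√l - √τ) / (√l + √τ)) ^ (2 * k)

/-- The point `((k + √(k² + α²))/α)² τ` where `f(·, τ)` attains its maximum over `[τ, ∞)`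
(see `isMaxOn_errFactor`). -/
def lamBar (α : ℝ) (k : ℕ) (τ : ℝ) : ℝ := ((k + √((k : ℝ) ^ 2 + α ^ 2)) / α) ^ 2 * τ

/-- The parameter `τ_k`
`= (-α √lam/(8k) ln(lam/c) + √((α √lam/(8k) ln(lam/c))² + (c lam)^(1/2)))²`. -/
def tauK (α c lam : ℝ) (k : ℕ) : ℝ :=
  (-(α * √lam / (8 * k) * Real.log (lam / c)) +
    √((α * √lam / (8 * k) * Real.log (lam / c)) ^ 2 + √(c * lam))) ^ 2

/-- `lamBar α k τ` is a maximum point of `f(·, τ)` over `[τ, ∞)`. -/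
theorem isMaxOn_errFactor {α : ℝ} (hα : 0 < α) {k : ℕ} (hk : 1 ≤ k) {τ : ℝ} (hτ : 0 < τ) :
    lamBar α k τ ∈ Set.Ici τ ∧
      IsMaxOn (fun l => errFactor α k l τ) (Set.Ici τ) (lamBar α k τ) := by
  have hk0 : (0 : ℝ) < k := by exact_mod_cast hk
  set r : ℝ := √((k : ℝ) ^ 2 + α ^ 2) with hr
  have hr2 : r ^ 2 = (k : ℝ) ^ 2 + α ^ 2 := Real.sq_sqrt (by positivity)
  have hr0 : 0 ≤ r := Real.sqrt_nonneg _
  set s₀ : ℝ := (k + r) / α with hs₀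
  have hαs : α * s₀ = k + r := by rw [hs₀]; field_simp
  have hrα : α < r := by nlinarith
  have hs1 : 1 < s₀ := by rw [hs₀, lt_div_iff₀ hα]; linarith
  have hquad : α * s₀ ^ 2 - 2 * k * s₀ - α = 0 := by
    have h : α * (α * s₀ ^ 2 - 2 * k * s₀ - α) = 0 := by
      have : α * (α * s₀ ^ 2 - 2 * k * s₀ - α) = (α * s₀) ^ 2 - 2 * k * (α * s₀) - α ^ 2 := by ring
      rw [this, hαs]; nlinarith
    exact (mul_eq_zero.1 h).resolve_left hα.ne'
  have hbar : lamBar α k τ = s₀ ^ 2 * τ := rfl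
  let H : ℝ → ℝ := fun s => -α * Real.log s + k * Real.log (s - 1) - k * Real.log (s + 1)
  have hderiv : ∀ s : ℝ, 1 < s →
      HasDerivAt H (-α * s⁻¹ + k * (1 / (s - 1)) - k * (1 / (s + 1))) s := by
    intro s hs
    have h1 := (Real.hasDerivAt_log (by linarith : s ≠ 0)).const_mul (-α)
    have h2 := (((hasDerivAt_id' s).sub_const 1).log (by linarith : s - 1 ≠ 0)).const_mul (k : ℝ)
    have h3 := (((hasDerivAt_id' s).add_const 1).log (by linarith : s + 1 ≠ 0)).const_mul (k : ℝ)
    exact (h1.add h2).sub h3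
  have hform : ∀ s : ℝ, 1 < s → -α * s⁻¹ + k * (1 / (s - 1)) - k * (1 / (s + 1)) =
      -(α * s ^ 2 - 2 * k * s - α) / (s * (s - 1) * (s + 1)) := by
    intro s hs
    have : s - 1 ≠ 0 := by linarith
    have : s + 1 ≠ 0 := by linarith
    have : s ≠ 0 := by linarith
    field_simp
    ring
  have hpoly : ∀ s : ℝ, α * s ^ 2 - 2 * k * s - α = (s - s₀) * (α * (s + s₀) - 2 * k) := by
    intro s; linear_combination hquad
  have hcont : ∀ D : Set ℝ, D ⊆ Set.Ioi 1 → ContinuousOn H D := fun D hD s hs =>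
    (hderiv s (hD hs)).continuousAt.continuousWithinAt
  have hmono : MonotoneOn H (Set.Ioc 1 s₀) := by
    refine monotoneOn_of_deriv_nonneg (convex_Ioc 1 s₀) (hcont _ fun s hs => hs.1) ?_ ?_
    · intro s hs
      rw [interior_Ioc] at hs
      exact (hderiv s hs.1).differentiableAt.differentiableWithinAt
    · intro s hs
      rw [interior_Ioc] at hs
      have h1 : 0 < s - 1 := by linarith [hs.1]
      have h0 : 0 < s := by linarith
      rw [(hderiv s hs.1).deriv, hform s hs.1, hpoly s]
      apply div_nonneg
      · have : 0 ≤ α * (s + s₀) - 2 * k := by nlinarith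
        nlinarith [hs.2]
      · positivity
  have hanti : AntitoneOn H (Set.Ici s₀) := by
    refine antitoneOn_of_deriv_nonpos (convex_Ici s₀) (hcont _ fun s hs => lt_of_lt_of_le hs1 hs) ?_ ?_
    · intro s hs
      rw [interior_Ici] at hs
      exact (hderiv s (hs1.trans hs)).differentiableAt.differentiableWithinAt
    · intro s hs
      rw [interior_Ici] at hs
      have hs' : s₀ < s := hs
      have h1 : 0 < s - 1 := by linarith
      have h0 : 0 < s := by linarith
      rw [(hderiv s (hs1.trans hs')).deriv, hform s (hs1.trans hs'), hpoly s]
      apply div_nonpos_of_nonpos_of_nonneg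
      · have : 0 ≤ α * (s + s₀) - 2 * k := by nlinarith
        nlinarith
      · positivity
  have hmax : ∀ s : ℝ, 1 < s → H s ≤ H s₀ := by
    intro s hs
    rcases le_total s s₀ with h | h
    · exact hmono ⟨hs, h⟩ ⟨hs1, le_rfl⟩ h
    · exact hanti (Set.mem_Ici.2 le_rfl) h h
  have hexp : ∀ s : ℝ, 1 < s → errFactor α k (s ^ 2 * τ) τ = Real.exp (2 * H s) := by
    intro s hs
    have h0 : 0 < s := by linarith
    have h1 : 0 < s - 1 := by linarith
    have h2 : 0 < s + 1 := by linarith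
    have hst : 0 < √τ := Real.sqrt_pos.2 hτ
    have hsq : √(s ^ 2 * τ) = s * √τ := by rw [Real.sqrt_mul (by positivity), Real.sqrt_sq h0.le]
    have hq : (s * √τ - √τ) / (s * √τ + √τ) = (s - 1) / (s + 1) := by
      field_simp
    unfold errFactor
    rw [hsq, hq, mul_div_cancel_right₀ _ hτ.ne', Real.rpow_def_of_pos (by positivity), Real.log_pow,
      ← Real.exp_log (show 0 < ((s - 1) / (s + 1)) ^ (2 * k) by positivity), Real.log_pow,
      Real.log_div h1.ne' h2.ne', ← Real.exp_add]
    congr 1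
    simp only [H]
    push_cast
    ring
  refine ⟨?_, ?_⟩
  · rw [hbar, Set.mem_Ici]
    exact le_mul_of_one_le_left hτ.le (one_le_pow₀ hs1.le)
  · intro l hl
    have hl' : τ ≤ l := hl
    show errFactor α k l τ ≤ errFactor α k (lamBar α k τ) τ
    rw [hbar, hexp s₀ hs1]
    rcases hl'.eq_or_lt with h | h
    · rw [← h]
      have : errFactor α k τ τ = 0 := by
        unfold errFactor
        rw [sub_self, zero_div, zero_pow (by omega), mul_zero]
      rw [this]
      exact (Real.exp_pos _).le
    · have hs : 1 < √(l / τ) := by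
        rw [Real.lt_sqrt (by norm_num), one_pow, lt_div_iff₀ hτ, one_mul]
        exact h
      have hl2 : l = (√(l / τ)) ^ 2 * τ := by
        rw [Real.sq_sqrt (div_pos (hτ.trans h) hτ).le]
        field_simp
      rw [hl2, hexp _ hs]
      exact Real.exp_le_exp.2 (by linarith [hmax _ hs])

end FracPow

end

/-!
The operator error is the largest scalar error `|l ^ (-α) - r(l)|` on the spectrum, where `r = scalarApprox α k τ` and
`τ = τ_k`. Up to the factor `2 sin(απ) τ^(1-α) / π`, the power `l ^ (-α)` is the integral of
`f(t) = 1 / (τ (1 - t) + l (1 + t))` against the Jacobi weight `ω` (`integral_jacobiWeight_div`: a Möbius substitution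
turns it into Euler's beta integral), and `r(l)` is the Gauss-Jacobi rule for this integral.

The rule is a genuine Gauss rule. The explicit polynomial `P_k` is orthogonal to all polynomials of lower degree, because
its moments are `k`-th finite differences of polynomials of degree less than `k`
(`jacobiFunctional_jacobiPoly_mul_pow`). Hence no nonconstant factor of `P_k` has constant sign on `(-1, 1)`
(`natDegree_eq_zero_of_dvd_jacobiPoly`), so `P_k` has `k` simple zeros, all in `(-1, 1)`; the rule is exact below degree
`2 k` and its weights are nonnegative. Its error is therefore at most `2 ∫ ω` times the distance from `f` to the
polynomials of degree less than `2 k` (`abs_integral_sub_sum_gaussWeight_le`). Dividing the Chebyshev polynomial `T_{2k}`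
by its value at the pole of `f` shows that this distance is at most a constant times `ρ^(2k)`, with
`ρ = |√l - √τ| / (√l + √τ)` (`exists_polynomial_approx_inv`).

It remains to bound `ρ^(2k)` for `l` in `[c, λ_N]` (`λ_N` is written `lam` below). By monotonicity `ρ` is at most
`(1 - y) / (1 + y)`, with `y = √(c/τ)` if `l ≤ τ` and with `y = √(τ/λ_N)` if `l ≥ τ`, and
`(1 - y) / (1 + y) ≤ exp(-2 y - 2 y³ / 3)` (`one_sub_div_one_add_le_exp`). The parameter `τ_k` is the value at which
`c^(-α) exp(-4 k √(c/τ))` and `λ_N^(-α) exp(-4 k √(τ/λ_N))` agree; both then equal their geometric mean, which is at most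
`(c λ_N)^(-α/2) exp(-4 k (c/λ_N)^(1/4))` (`exponent_le_of_quadratic`). Since `τ_k` is bounded below uniformly in `k`, the
cubic terms leave a factor `exp(-k e)` with `e > 0` independent of `k`, and `exp(-k e) ≤ 1 / (k e)` absorbs every
constant into the term `C / k`.
-/

noncomputable section

namespace FracPow

open MeasureTheory Set Polynomial

/-! ### Beta integrals and the Jacobi weight -/

theorem integrableOn_betaKernel {u v : ℝ} (hu : 0 < u) (hv : 0 < v) :
    IntegrableOn (fun x : ℝ => x ^ (u - 1) * (1 - x) ^ (v - 1)) (Ioo 0 1) ∧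
      ∫ x in Ioo (0 : ℝ) 1, x ^ (u - 1) * (1 - x) ^ (v - 1) = ProbabilityTheory.beta u v := by
  have hconv := Complex.betaIntegral_convergent (u := (u : ℂ)) (v := (v : ℂ)) (by simpa) (by simpa)
  rw [intervalIntegrable_iff_integrableOn_Ioo_of_le zero_le_one] at hconv
  have heq : ∀ x ∈ Ioo (0 : ℝ) 1, (x : ℂ) ^ ((u : ℂ) - 1) * (1 - (x : ℂ)) ^ ((v : ℂ) - 1) =
      ((x ^ (u - 1) * (1 - x) ^ (v - 1) : ℝ) : ℂ) := by
    intro x hx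
    have h1 : (0 : ℝ) ≤ 1 - x := by linarith [hx.2]
    rw [Complex.ofReal_mul, Complex.ofReal_cpow hx.1.le, Complex.ofReal_cpow h1]
    push_cast
    rfl
  have hint : IntegrableOn (fun x : ℝ => ((x ^ (u - 1) * (1 - x) ^ (v - 1) : ℝ) : ℂ)) (Ioo 0 1) :=
    hconv.congr_fun heq measurableSet_Ioo
  refine ⟨by simpa [IntegrableOn] using hint.re, ?_⟩
  rw [ProbabilityTheory.beta_eq_betaIntegralReal u v hu hv, Complex.betaIntegral,
    intervalIntegral.integral_of_le zero_le_one, integral_Ioc_eq_integral_Ioo,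
    setIntegral_congr_fun measurableSet_Ioo heq, integral_complex_ofReal, Complex.ofReal_re]

/-- The Möbius substitution `v = l (1 + t) / (τ (1 - t) + l (1 + t))`, which maps `(-1, 1)` onto `(0, 1)`, turns Euler's
beta integral into an integral over `(-1, 1)` with a pole outside that interval. -/
theorem integral_moebius {p q l τ : ℝ} (hp : 0 < p) (hq : 0 < q) (hl : 0 < l) (hτ : 0 < τ) :
    IntegrableOn (fun t : ℝ => (1 + t) ^ (p - 1) * (1 - t) ^ (q - 1) *
        (τ * (1 - t) + l * (1 + t)) ^ (-(p + q))) (Ioo (-1) 1) ∧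
      ∫ t in Ioo (-1 : ℝ) 1, (1 + t) ^ (p - 1) * (1 - t) ^ (q - 1) *
        (τ * (1 - t) + l * (1 + t)) ^ (-(p + q)) =
        ProbabilityTheory.beta p q / (2 * l ^ p * τ ^ q) := by
  set D : ℝ → ℝ := fun t => τ * (1 - t) + l * (1 + t) with hD
  set φ : ℝ → ℝ := fun t => l * (1 + t) / D t with hφ
  have hDpos : ∀ t ∈ Ioo (-1 : ℝ) 1, 0 < D t := by
    intro t ht
    have h1 : 0 < 1 - t := by linarith [ht.2]
    have h2 : 0 < 1 + t := by linarith [ht.1]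
    simp only [hD]; positivity
  have h1φ : ∀ t ∈ Ioo (-1 : ℝ) 1, 1 - φ t = τ * (1 - t) / D t := by
    intro t ht
    have := (hDpos t ht).ne'
    rw [hφ, eq_div_iff this]
    simp only
    rw [sub_mul, div_mul_cancel₀ _ this]
    simp only [hD]; ring
  have hderiv : ∀ t ∈ Ioo (-1 : ℝ) 1,
      HasDerivWithinAt φ (2 * l * τ / D t ^ 2) (Ioo (-1) 1) t := by
    intro t ht
    have hD' : HasDerivAt D (l - τ) t := by
      have := (((hasDerivAt_id' t).const_sub 1).const_mul τ).add
        (((hasDerivAt_id' t).const_add 1).const_mul l)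
      exact this.congr_deriv (by ring)
    have hN : HasDerivAt (fun t : ℝ => l * (1 + t)) l t := by
      simpa using ((hasDerivAt_id' t).const_add 1).const_mul l
    have := (hN.div hD' (hDpos t ht).ne').hasDerivWithinAt (s := Ioo (-1) 1)
    refine this.congr_deriv ?_
    congr 1
    simp only [hD]; ring
  have hinj : InjOn φ (Ioo (-1) 1) := by
    intro s hs t ht hst
    have h1 := (hDpos s hs).ne'
    have h2 := (hDpos t ht).ne'
    simp only [hφ] at hst
    rw [div_eq_div_iff h1 h2] at hst
    have h3 : (2 * l * τ) * (s - t) = 0 := by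
      simp only [hD] at hst; linear_combination hst
    have h4 : 2 * l * τ ≠ 0 := by positivity
    linarith [(mul_eq_zero.1 h3).resolve_left h4]
  have himage : φ '' Ioo (-1) 1 = Ioo 0 1 := by
    ext v
    constructor
    · rintro ⟨t, ht, rfl⟩
      have hd := hDpos t ht
      have h1 : 0 < 1 - t := by linarith [ht.2]
      have h2 : 0 < 1 + t := by linarith [ht.1]
      refine ⟨by simp only [hφ]; positivity, ?_⟩
      have : 0 < 1 - φ t := by rw [h1φ t ht]; positivity
      linarith
    · rintro ⟨hv0, hv1⟩
      have h1 : 0 < 1 - v := by linarith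
      have hE : 0 < τ * v + l * (1 - v) := by positivity
      refine ⟨(τ * v - l * (1 - v)) / (τ * v + l * (1 - v)), ⟨?_, ?_⟩, ?_⟩
      · rw [lt_div_iff₀ hE]; nlinarith [mul_pos hτ hv0]
      · rw [div_lt_one hE]; nlinarith [mul_pos hl h1]
      · have ha : 1 + (τ * v - l * (1 - v)) / (τ * v + l * (1 - v)) =
            2 * τ * v / (τ * v + l * (1 - v)) := by field_simp; ring
        have hb : 1 - (τ * v - l * (1 - v)) / (τ * v + l * (1 - v)) =
            2 * l * (1 - v) / (τ * v + l * (1 - v)) := by field_simp; ring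
        simp only [hφ, hD, ha, hb]
        field_simp
        ring
  have hpull : ∀ t ∈ Ioo (-1 : ℝ) 1,
      |2 * l * τ / D t ^ 2| • (φ t ^ (p - 1) * (1 - φ t) ^ (q - 1)) =
        (2 * l ^ p * τ ^ q) * ((1 + t) ^ (p - 1) * (1 - t) ^ (q - 1) * D t ^ (-(p + q))) := by
    intro t ht
    have hd := hDpos t ht
    have h1 : 0 < 1 - t := by linarith [ht.2]
    have h2 : 0 < 1 + t := by linarith [ht.1]
    rw [abs_of_pos (by positivity), smul_eq_mul, h1φ t ht]
    simp only [hφ]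
    rw [Real.div_rpow (by positivity) hd.le, Real.div_rpow (by positivity) hd.le,
      Real.mul_rpow hl.le h2.le, Real.mul_rpow hτ.le h1.le, Real.rpow_neg hd.le,
      show p + q = (p - 1) + (q - 1) + 2 by ring, Real.rpow_add hd, Real.rpow_add hd,
      Real.rpow_two, Real.rpow_sub_one hl.ne', Real.rpow_sub_one hτ.ne']
    field_simp
  have hJ := integrableOn_image_iff_integrableOn_abs_deriv_smul measurableSet_Ioo hderiv hinj
    (fun x : ℝ => x ^ (p - 1) * (1 - x) ^ (q - 1))
  have hI := integral_image_eq_integral_abs_deriv_smul measurableSet_Ioo hderiv hinj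
    (fun x : ℝ => x ^ (p - 1) * (1 - x) ^ (q - 1))
  have hK : 2 * l ^ p * τ ^ q ≠ 0 := by positivity
  rw [himage] at hJ hI
  rw [integrableOn_congr_fun hpull measurableSet_Ioo] at hJ
  rw [setIntegral_congr_fun measurableSet_Ioo hpull, (integrableOn_betaKernel hp hq).2,
    integral_const_mul] at hI
  refine ⟨?_, ?_⟩
  · have : IntegrableOn _ (Ioo (-1 : ℝ) 1) :=
      (hJ.1 (integrableOn_betaKernel hp hq).1).const_mul (2 * l ^ p * τ ^ q)⁻¹
    refine this.congr_fun (fun t _ => ?_) measurableSet_Ioo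
    simp only
    rw [inv_mul_cancel_left₀ hK]
  · rw [hI, mul_div_cancel_left₀ _ hK]

/-- The moments of the Jacobi weight in the basis `(1 - t)^i (1 + t)^j`. -/
theorem integral_jacobiWeight_moment {α : ℝ} (hα0 : 0 < α) (hα1 : α < 1) (i j : ℕ) :
    IntegrableOn (fun t : ℝ => (1 - t) ^ i * (1 + t) ^ j * jacobiWeight α t) (Ioo (-1) 1) ∧
      ∫ t in Ioo (-1 : ℝ) 1, (1 - t) ^ i * (1 + t) ^ j * jacobiWeight α t =
        2 ^ (i + j) * (Real.Gamma (i + 1 - α) * Real.Gamma (j + α) / Real.Gamma (i + j + 1)) := by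
  have hq : (0 : ℝ) < i + 1 - α := by have : (0 : ℝ) ≤ i := i.cast_nonneg; linarith
  have hp : (0 : ℝ) < j + α := by positivity
  obtain ⟨h1, h2⟩ := integral_moebius hp hq one_pos one_pos
  have hcongr : ∀ t ∈ Ioo (-1 : ℝ) 1,
      2 ^ (i + j + 1) * ((1 + t) ^ (j + α - 1) * (1 - t) ^ (i + 1 - α - 1) *
        (1 * (1 - t) + 1 * (1 + t)) ^ (-(j + α + (i + 1 - α)))) =
      (1 - t) ^ i * (1 + t) ^ j * jacobiWeight α t := by
    intro t ht
    have ha : 0 < 1 - t := by linarith [ht.2]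
    have hb : 0 < 1 + t := by linarith [ht.1]
    rw [show (1 * (1 - t) + 1 * (1 + t) : ℝ) = 2 by ring,
      show -((j : ℝ) + α + (i + 1 - α)) = -((i + j + 1 : ℕ) : ℝ) by push_cast; ring,
      Real.rpow_neg two_pos.le, Real.rpow_natCast, jacobiWeight,
      show (j : ℝ) + α - 1 = (α - 1) + (j : ℕ) by ring,
      show (i : ℝ) + 1 - α - 1 = -α + (i : ℕ) by ring,
      Real.rpow_add_natCast hb.ne', Real.rpow_add_natCast ha.ne']
    field_simp
  refine ⟨IntegrableOn.congr_fun (h1.const_mul (2 ^ (i + j + 1))) hcongr measurableSet_Ioo, ?_⟩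
  rw [← setIntegral_congr_fun measurableSet_Ioo hcongr, integral_const_mul, h2,
    ProbabilityTheory.beta, Real.one_rpow, Real.one_rpow,
    show (j : ℝ) + α + (i + 1 - α) = i + j + 1 by ring, pow_succ]
  ring

theorem Gamma_mul_Gamma_eq {α : ℝ} :
    Real.Gamma α * Real.Gamma (1 - α) = Real.pi / Real.sin (α * Real.pi) := by
  rw [Real.Gamma_mul_Gamma_one_sub, mul_comm Real.pi]

theorem integrableOn_jacobiWeight {α : ℝ} (hα0 : 0 < α) (hα1 : α < 1) :
    IntegrableOn (jacobiWeight α) (Ioo (-1) 1) := by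
  simpa using (integral_jacobiWeight_moment hα0 hα1 0 0).1

theorem integral_jacobiWeight {α : ℝ} (hα0 : 0 < α) (hα1 : α < 1) :
    ∫ t in Ioo (-1 : ℝ) 1, jacobiWeight α t = Real.pi / Real.sin (α * Real.pi) := by
  rw [← Gamma_mul_Gamma_eq, mul_comm]
  simpa using (integral_jacobiWeight_moment hα0 hα1 0 0).2

/-- The integral representation of `l ^ (-α)` that the Gauss-Jacobi rule discretizes. -/
theorem integral_jacobiWeight_div {α l τ : ℝ} (hα0 : 0 < α) (hα1 : α < 1) (hl : 0 < l)
    (hτ : 0 < τ) :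
    IntegrableOn (fun t : ℝ => (τ * (1 - t) + l * (1 + t))⁻¹ * jacobiWeight α t) (Ioo (-1) 1) ∧
      2 * Real.sin (α * Real.pi) * τ ^ (1 - α) / Real.pi *
        ∫ t in Ioo (-1 : ℝ) 1, (τ * (1 - t) + l * (1 + t))⁻¹ * jacobiWeight α t = l ^ (-α) := by
  obtain ⟨h1, h2⟩ := integral_moebius hα0 (sub_pos.2 hα1) hl hτ
  have hcongr : ∀ t ∈ Ioo (-1 : ℝ) 1,
      (1 + t) ^ (α - 1) * (1 - t) ^ (1 - α - 1) *
        (τ * (1 - t) + l * (1 + t)) ^ (-(α + (1 - α))) =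
      (τ * (1 - t) + l * (1 + t))⁻¹ * jacobiWeight α t := by
    intro t ht
    rw [show -(α + (1 - α)) = -1 by ring, Real.rpow_neg_one, jacobiWeight,
      show 1 - α - 1 = -α by ring]
    ring
  refine ⟨h1.congr_fun hcongr measurableSet_Ioo, ?_⟩
  have hs : 0 < Real.sin (α * Real.pi) :=
    Real.sin_pos_of_pos_of_lt_pi (by positivity) (by nlinarith [Real.pi_pos])
  have hpi := Real.pi_pos
  have hτ' : τ ^ (1 - α) ≠ 0 := by positivity
  rw [← setIntegral_congr_fun measurableSet_Ioo hcongr, h2, ProbabilityTheory.beta,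
    Gamma_mul_Gamma_eq, show α + (1 - α) = 1 by ring, Real.Gamma_one, Real.rpow_neg hl.le]
  field_simp

theorem jacobiWeight_pos {α t : ℝ} (ht : t ∈ Ioo (-1 : ℝ) 1) : 0 < jacobiWeight α t := by
  have h1 : 0 < 1 - t := by linarith [ht.2]
  have h2 : 0 < 1 + t := by linarith [ht.1]
  unfold jacobiWeight; positivity

/-! ### Orthogonality of the Jacobi polynomials -/

theorem ascPochhammer_eval_eq_Gamma_div {x : ℝ} (hx : 0 < x) (n : ℕ) :
    (ascPochhammer ℝ n).eval x = Real.Gamma (x + n) / Real.Gamma x := by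
  have hG := (Real.Gamma_pos_of_pos hx).ne'
  induction n with
  | zero => simp [hG]
  | succ n ih =>
    have : x + n ≠ 0 := by positivity
    rw [ascPochhammer_succ_eval, ih, Nat.cast_succ, ← add_assoc, Real.Gamma_add_one this]
    ring

theorem choose_eq_Gamma_div {x : ℝ} (hx : 0 < x) (n : ℕ) :
    Ring.choose (x + n - 1) n = Real.Gamma (x + n) / (n.factorial * Real.Gamma x) := by
  have h1 := Ring.factorial_nsmul_multichoose_eq_ascPochhammer x n
  rw [Ring.multichoose_eq, ascPochhammer_smeval_eq_eval, nsmul_eq_mul,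
    ascPochhammer_eval_eq_Gamma_div hx] at h1
  have : (n.factorial : ℝ) ≠ 0 := by exact_mod_cast n.factorial_ne_zero
  have hG := (Real.Gamma_pos_of_pos hx).ne'
  field_simp at h1 ⊢
  linarith

theorem sum_alternating_choose_mul_eval_eq_zero {p : ℝ[X]} {k : ℕ} (hp : p.natDegree < k) (y : ℝ) :
    ∑ s ∈ Finset.range (k + 1), (-1 : ℝ) ^ s * (k.choose s) * p.eval (y + s) = 0 := by
  have h1 := congrFun (Polynomial.fwdDiff_iter_eq_zero_of_degree_lt hp) y
  rw [fwdDiff_iter_eq_sum_shift] at h1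
  have h2 : ∑ s ∈ Finset.range (k + 1), (-1 : ℝ) ^ s * (k.choose s) * p.eval (y + s) =
      (-1) ^ k * ∑ s ∈ Finset.range (k + 1),
        ((-1 : ℤ) ^ (k - s) * (k.choose s : ℤ)) • p.eval (y + s • (1 : ℝ)) := by
    rw [Finset.mul_sum]
    refine Finset.sum_congr rfl fun s hs => ?_
    have hs' : s ≤ k := Nat.lt_succ_iff.1 (Finset.mem_range.1 hs)
    have hsign : (-1 : ℝ) ^ s = (-1) ^ k * (-1) ^ (k - s) := by
      have h3 : (-1 : ℝ) ^ k = (-1) ^ s * (-1) ^ (k - s) := by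
        rw [← pow_add, Nat.add_sub_of_le hs']
      rw [h3, mul_assoc, ← mul_pow]; simp
    rw [hsign, zsmul_eq_mul, nsmul_eq_mul, mul_one]
    push_cast
    ring
  rw [h2, h1]
  simp

theorem integrableOn_eval_mul_jacobiWeight {α : ℝ} (hα0 : 0 < α) (hα1 : α < 1) (p : ℝ[X]) :
    IntegrableOn (fun t => p.eval t * jacobiWeight α t) (Ioo (-1) 1) :=
  (integrableOn_jacobiWeight hα0 hα1).continuousOn_mul_of_subset p.continuous.continuousOn
    isCompact_Icc measurableSet_Ioo Ioo_subset_Icc_self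

/-- The linear functional `p ↦ ∫ p ω` on polynomials, for the Jacobi weight `ω` on `(-1, 1)`. -/
def jacobiFunctional {α : ℝ} (hα0 : 0 < α) (hα1 : α < 1) : ℝ[X] →ₗ[ℝ] ℝ where
  toFun p := ∫ t in Ioo (-1 : ℝ) 1, p.eval t * jacobiWeight α t
  map_add' p q := by
    rw [← integral_add (integrableOn_eval_mul_jacobiWeight hα0 hα1 p)
      (integrableOn_eval_mul_jacobiWeight hα0 hα1 q)]
    simp only [eval_add, add_mul]
  map_smul' c p := by
    rw [RingHom.id_apply, smul_eq_mul, ← integral_const_mul]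
    simp only [eval_smul, smul_eq_mul, mul_assoc]

theorem jacobiFunctional_apply {α : ℝ} (hα0 : 0 < α) (hα1 : α < 1) (p : ℝ[X]) :
    jacobiFunctional hα0 hα1 p = ∫ t in Ioo (-1 : ℝ) 1, p.eval t * jacobiWeight α t := rfl

theorem jacobiFunctional_nonneg {α : ℝ} (hα0 : 0 < α) (hα1 : α < 1) {p : ℝ[X]} (h : ∀ t ∈ Ioo (-1 : ℝ) 1, 0 ≤ p.eval t) :
    0 ≤ jacobiFunctional hα0 hα1 p :=
  setIntegral_nonneg measurableSet_Ioo fun t ht => mul_nonneg (h t ht) (jacobiWeight_pos ht).le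

theorem jacobiFunctional_pos {α : ℝ} (hα0 : 0 < α) (hα1 : α < 1) {p : ℝ[X]} (hp : p ≠ 0) (h : ∀ t ∈ Ioo (-1 : ℝ) 1, 0 ≤ p.eval t) :
    0 < jacobiFunctional hα0 hα1 p := by
  refine (jacobiFunctional_nonneg hα0 hα1 h).lt_of_ne' fun h0 => ?_
  rw [jacobiFunctional_apply, setIntegral_eq_zero_iff_of_nonneg_ae ?_
    (integrableOn_eval_mul_jacobiWeight hα0 hα1 p)] at h0
  · rw [Filter.EventuallyEq, ae_restrict_iff' measurableSet_Ioo] at h0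
    have hfin : volume {t : ℝ | p.IsRoot t} = 0 :=
      (p.finite_setOfPred_isRoot hp).measure_zero _
    have hsub : volume (Ioo (-1 : ℝ) 1) ≤ volume {t : ℝ | p.IsRoot t} := by
      refine measure_mono_ae ?_
      filter_upwards [h0] with t ht htI
      exact (mul_eq_zero.1 (ht htI)).resolve_right (jacobiWeight_pos htI).ne'
    rw [hfin, Real.volume_Ioo] at hsub
    norm_num at hsub
  · rw [Filter.EventuallyLE, ae_restrict_iff' measurableSet_Ioo]
    exact Filter.Eventually.of_forall fun t ht => mul_nonneg (h t ht) (jacobiWeight_pos ht).le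

/-- In terms of Gamma functions, the `s`-th term of `P_k` contributes to the moment against `(1 - t)^i` a multiple,
independent of `s`, of `(-1)^s binom(k, s)` times a polynomial of degree `i` in `s`; so the moment is a `k`-th finite
difference of a polynomial of degree less than `k`. -/
theorem jacobiFunctional_jacobiPoly_mul_pow {α : ℝ} (hα0 : 0 < α) (hα1 : α < 1) {k i : ℕ} (hi : i < k) :
    jacobiFunctional hα0 hα1 (jacobiPoly (-α) (α - 1) k * (1 - X) ^ i) = 0 := by
  rw [jacobiPoly, Finset.sum_mul, map_sum]
  set K : ℝ := 2 ^ i * Real.Gamma (k + 1 - α) * Real.Gamma (k + α) /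
    (k.factorial * Real.Gamma (k + i + 1)) with hK
  have hterm : ∀ s ∈ Finset.range (k + 1),
      jacobiFunctional hα0 hα1 (C (Ring.choose ((k : ℝ) + -α) (k - s) *
          Ring.choose ((k : ℝ) + (α - 1)) s) * (C (1 / 2) * (X - 1)) ^ s *
          (C (1 / 2) * (X + 1)) ^ (k - s) * (1 - X) ^ i) =
        K * ((-1) ^ s * k.choose s * (ascPochhammer ℝ i).eval ((1 - α) + s)) := by
    intro s hs
    obtain ⟨m, rfl⟩ := Nat.exists_eq_add_of_le (Nat.lt_succ_iff.1 (Finset.mem_range.1 hs))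
    have hs1 : (0 : ℝ) < s + 1 - α := by
      have : (0 : ℝ) ≤ s := s.cast_nonneg
      linarith
    have hm1 : (0 : ℝ) < m + α := by positivity
    have hc1 := choose_eq_Gamma_div hs1 m
    have hc2 := choose_eq_Gamma_div hm1 s
    have hcongr : ∀ t : ℝ, ((C (Ring.choose (((s + m : ℕ) : ℝ) + -α) (s + m - s) *
          Ring.choose (((s + m : ℕ) : ℝ) + (α - 1)) s) * (C (1 / 2) * (X - 1)) ^ s *
          (C (1 / 2) * (X + 1)) ^ (s + m - s) * (1 - X) ^ i : ℝ[X])).eval t * jacobiWeight α t =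
        (Ring.choose ((s : ℝ) + 1 - α + m - 1) m * Ring.choose ((m : ℝ) + α + s - 1) s * (-1) ^ s *
          (1 / 2) ^ (s + m)) * ((1 - t) ^ (s + i) * (1 + t) ^ m * jacobiWeight α t) := by
      intro t
      rw [Nat.add_sub_cancel_left,
        show (((s + m : ℕ) : ℝ) + -α) = (s : ℝ) + 1 - α + m - 1 by push_cast; ring,
        show (((s + m : ℕ) : ℝ) + (α - 1)) = (m : ℝ) + α + s - 1 by push_cast; ring]
      simp only [eval_mul, eval_pow, eval_sub, eval_add, eval_C, eval_X, eval_one, mul_pow]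
      rw [show t - 1 = (-1) * (1 - t) by ring, mul_pow]
      ring
    rw [jacobiFunctional_apply]
    simp_rw [hcongr]
    rw [integral_const_mul, (integral_jacobiWeight_moment hα0 hα1 (s + i) m).2, hc1, hc2,
      show (1 - α) + (s : ℝ) = s + 1 - α by ring, ascPochhammer_eval_eq_Gamma_div hs1, hK,
      Nat.cast_add_choose]
    have e1 : (s : ℝ) + 1 - α + m = ((s + m : ℕ) : ℝ) + 1 - α := by push_cast; ring
    have e2 : (m : ℝ) + α + s = ((s + m : ℕ) : ℝ) + α := by push_cast; ring
    have e3 : ((s + i : ℕ) : ℝ) + 1 - α = s + 1 - α + i := by push_cast; ring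
    have e4 : ((s + i : ℕ) : ℝ) + m + 1 = ((s + m : ℕ) : ℝ) + i + 1 := by push_cast; ring
    rw [e1, e2, e3, e4]
    have g1 := (Real.Gamma_pos_of_pos hs1).ne'
    have g2 := (Real.Gamma_pos_of_pos hm1).ne'
    have g3 : Real.Gamma (((s + m : ℕ) : ℝ) + i + 1) ≠ 0 :=
      (Real.Gamma_pos_of_pos (by positivity)).ne'
    have f1 : ((s + m).factorial : ℝ) ≠ 0 := by positivity
    have f2 : (s.factorial : ℝ) ≠ 0 := by positivity
    have f3 : (m.factorial : ℝ) ≠ 0 := by positivity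
    rw [one_div, inv_pow]
    field_simp
    ring
  rw [Finset.sum_congr rfl hterm, ← Finset.mul_sum,
    sum_alternating_choose_mul_eval_eq_zero (by rwa [ascPochhammer_natDegree]), mul_zero]

theorem jacobiFunctional_jacobiPoly_mul {α : ℝ} (hα0 : 0 < α) (hα1 : α < 1) {k : ℕ} {q : ℝ[X]} (hq : q.degree < k) :
    jacobiFunctional hα0 hα1 (jacobiPoly (-α) (α - 1) k * q) = 0 := by
  rw [← sum_taylor_eq q 1, Polynomial.sum, Finset.mul_sum, map_sum]
  refine Finset.sum_eq_zero fun i hi => ?_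
  have hik : i < k := by
    have h1 := le_degree_of_mem_supp i hi
    rw [degree_taylor] at h1
    exact_mod_cast h1.trans_lt hq
  have : jacobiPoly (-α) (α - 1) k * (C ((taylor 1 q).coeff i) * (X - C 1) ^ i) =
      ((taylor 1 q).coeff i * (-1) ^ i) • (jacobiPoly (-α) (α - 1) k * (1 - X) ^ i) := by
    rw [smul_eq_C_mul, C_mul, C_pow, C_neg, C_1, show (X - 1 : ℝ[X]) = (-1) * (1 - X) by ring,
      mul_pow]
    ring
  rw [this, map_smul, jacobiFunctional_jacobiPoly_mul_pow hα0 hα1 hik, smul_zero]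

/-! ### Zeros of the Jacobi polynomials and Gauss-Jacobi quadrature -/

theorem natDegree_jacobiPoly_le (a b : ℝ) (k : ℕ) : (jacobiPoly a b k).natDegree ≤ k := by
  refine natDegree_sum_le_of_forall_le _ _ fun s hs => ?_
  have hs' : s ≤ k := Nat.lt_succ_iff.1 (Finset.mem_range.1 hs)
  calc _ ≤ 0 + s * 1 + (k - s) * 1 := by
        refine natDegree_mul_le_of_le (natDegree_mul_le_of_le (natDegree_C _).le ?_) ?_
        · refine natDegree_pow_le_of_le _ ((natDegree_C_mul_le _ _).trans ?_)
          simpa using natDegree_X_sub_C_le (1 : ℝ)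
        · refine natDegree_pow_le_of_le _ ((natDegree_C_mul_le _ _).trans ?_)
          simpa using (natDegree_X_add_C (1 : ℝ)).le
    _ = k := by omega

/-- The value of `P_k` at `1` is a positive binomial coefficient. -/
theorem jacobiPoly_ne_zero {α : ℝ} (hα1 : α < 1) (k : ℕ) : jacobiPoly (-α) (α - 1) k ≠ 0 := by
  intro h
  have h1 : (jacobiPoly (-α) (α - 1) k).eval 1 = Ring.choose ((k : ℝ) + -α) k := by
    rw [jacobiPoly, eval_finsetSum, Finset.sum_eq_single 0]
    · simp; norm_num
    · intro s _ hs
      simp [hs]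
    · simp
  have h2 := choose_eq_Gamma_div (sub_pos.2 hα1) k
  rw [show (1 - α + k - 1 : ℝ) = k + -α by ring, ← h1, h, eval_zero] at h2
  have g1 := Real.Gamma_pos_of_pos (sub_pos.2 hα1)
  have g2 : 0 < Real.Gamma (1 - α + k) :=
    Real.Gamma_pos_of_pos (by have := sub_pos.2 hα1; positivity)
  have : 0 < Real.Gamma (1 - α + k) / (k.factorial * Real.Gamma (1 - α)) := by positivity
  linarith

/-- A degree smaller than `k` would make `P_k` orthogonal to itself. -/
theorem natDegree_jacobiPoly {α : ℝ} (hα0 : 0 < α) (hα1 : α < 1) (k : ℕ) : (jacobiPoly (-α) (α - 1) k).natDegree = k := by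
  refine (natDegree_jacobiPoly_le _ _ k).antisymm (not_lt.1 fun hlt => ?_)
  have hP := jacobiPoly_ne_zero hα1 k
  have h1 := jacobiFunctional_jacobiPoly_mul hα0 hα1 (k := k)
    (q := jacobiPoly (-α) (α - 1) k) ((natDegree_lt_iff_degree_lt hP).1 hlt)
  have h2 := jacobiFunctional_pos hα0 hα1 (mul_ne_zero hP hP) fun t _ => by
    rw [eval_mul]; exact mul_self_nonneg _
  linarith

/-- If `P_k = h g` with `h` nonnegative on `(-1, 1)` and nonconstant, then `P_k` would be orthogonal to `g`, although
`∫ P_k g ω = ∫ h g² ω > 0`. -/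
theorem natDegree_eq_zero_of_dvd_jacobiPoly {α : ℝ} (hα0 : 0 < α) (hα1 : α < 1) {k : ℕ} {h : ℝ[X]}
    (hdvd : h ∣ jacobiPoly (-α) (α - 1) k) (hpos : ∀ t ∈ Ioo (-1 : ℝ) 1, 0 ≤ h.eval t) :
    h.natDegree = 0 := by
  obtain ⟨g, hg⟩ := hdvd
  have hP := jacobiPoly_ne_zero hα1 k
  have hh0 : h ≠ 0 := by rintro rfl; exact hP (by rw [hg, zero_mul])
  have hg0 : g ≠ 0 := by rintro rfl; exact hP (by rw [hg, mul_zero])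
  by_contra hne
  have hdeg : h.natDegree + g.natDegree = k := by
    rw [← natDegree_mul hh0 hg0, ← hg, natDegree_jacobiPoly hα0 hα1]
  have h1 := jacobiFunctional_jacobiPoly_mul hα0 hα1 (k := k) (q := g)
    ((natDegree_lt_iff_degree_lt hg0).1 (by omega))
  have h2 := jacobiFunctional_pos hα0 hα1 (p := jacobiPoly (-α) (α - 1) k * g)
    (mul_ne_zero hP hg0) fun t ht => by
      rw [hg, eval_mul, eval_mul, mul_assoc]
      exact mul_nonneg (hpos t ht) (mul_self_nonneg _)
  linarith

theorem splits_jacobiPoly {α : ℝ} (hα0 : 0 < α) (hα1 : α < 1) (k : ℕ) : (jacobiPoly (-α) (α - 1) k).Splits := by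
  have hP := jacobiPoly_ne_zero hα1 k
  obtain ⟨u, hu⟩ := UniqueFactorizationMonoid.factors_prod hP
  rw [← hu]
  refine (Splits.multisetProd fun g hgP => ?_).mul u.isUnit.splits
  have hg := UniqueFactorizationMonoid.irreducible_of_factor g hgP
  have hdvd := UniqueFactorizationMonoid.dvd_of_mem_factors hgP
  refine Splits.of_degree_eq_one ?_
  by_contra hne
  -- An irreducible factor without real zeros has constant sign, by the intermediate value theorem.
  have hroot : ∀ t : ℝ, g.eval t ≠ 0 := fun t ht =>
    hne (degree_eq_one_of_irreducible_of_root hg ht)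
  have hsign : (∀ t, 0 < g.eval t) ∨ ∀ t, 0 < (-g).eval t := by
    by_contra! hcon
    obtain ⟨⟨a, ha⟩, b, hb⟩ := hcon
    rw [eval_neg] at hb
    obtain ⟨t, ht⟩ := mem_range_of_exists_le_of_exists_ge g.continuous ⟨a, ha⟩
      ⟨b, (by linarith : (0 : ℝ) ≤ g.eval b)⟩
    exact hroot t ht
  have hd := hg.natDegree_pos
  rcases hsign with h | h
  · have := natDegree_eq_zero_of_dvd_jacobiPoly hα0 hα1 hdvd fun t _ => (h t).le
    omega
  · have := natDegree_eq_zero_of_dvd_jacobiPoly hα0 hα1 (neg_dvd.2 hdvd) fun t _ => (h t).le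
    rw [natDegree_neg] at this
    omega

theorem mem_gaussNodes {α : ℝ} (hα1 : α < 1) {k : ℕ} {ϑ : ℝ} :
    ϑ ∈ gaussNodes α k ↔ (jacobiPoly (-α) (α - 1) k).eval ϑ = 0 := by
  rw [gaussNodes, Multiset.mem_toFinset, mem_roots (jacobiPoly_ne_zero hα1 k), IsRoot.def]

theorem card_gaussNodes {α : ℝ} (hα0 : 0 < α) (hα1 : α < 1) (k : ℕ) : (gaussNodes α k).card = k := by
  have hP := jacobiPoly_ne_zero hα1 k
  have hnodup : (jacobiPoly (-α) (α - 1) k).roots.Nodup := by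
    rw [Multiset.nodup_iff_count_le_one]
    intro r
    by_contra! hlt
    rw [count_roots] at hlt
    have hdvd : (X - C r) ^ 2 ∣ jacobiPoly (-α) (α - 1) k :=
      (le_rootMultiplicity_iff hP).1 hlt
    have := natDegree_eq_zero_of_dvd_jacobiPoly hα0 hα1 hdvd fun t _ => by
      rw [eval_pow]; positivity
    rw [natDegree_pow, natDegree_X_sub_C] at this
    omega
  rw [gaussNodes, Multiset.toFinset_card_of_nodup hnodup,
    splits_iff_card_roots.1 (splits_jacobiPoly hα0 hα1 k), natDegree_jacobiPoly hα0 hα1]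

theorem gaussNodes_subset {α : ℝ} (hα0 : 0 < α) (hα1 : α < 1) (k : ℕ) : ↑(gaussNodes α k) ⊆ Ioo (-1 : ℝ) 1 := by
  intro ϑ hϑ
  rw [Finset.mem_coe, mem_gaussNodes hα1] at hϑ
  have hdvd := dvd_iff_isRoot.2 hϑ
  by_contra hout
  rw [mem_Ioo, not_and_or, not_lt, not_lt] at hout
  rcases hout with h | h
  · have := natDegree_eq_zero_of_dvd_jacobiPoly hα0 hα1 hdvd fun t ht => by
      simp only [eval_sub, eval_X, eval_C]; linarith [ht.1]
    rw [natDegree_X_sub_C] at this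
    omega
  · have := natDegree_eq_zero_of_dvd_jacobiPoly hα0 hα1 (neg_dvd.2 hdvd) fun t ht => by
      simp only [eval_neg, eval_sub, eval_X, eval_C]; linarith [ht.2]
    rw [natDegree_neg, natDegree_X_sub_C] at this
    omega

theorem gaussWeight_eq {α : ℝ} (hα0 : 0 < α) (hα1 : α < 1) (k : ℕ) (ϑ : ℝ) :
    gaussWeight α k ϑ = jacobiFunctional hα0 hα1 (Lagrange.basis (gaussNodes α k) id ϑ) := by
  rw [gaussWeight, intervalIntegral.integral_of_le (by norm_num), integral_Ioc_eq_integral_Ioo]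
  rfl

/-- The `k`-point Gauss-Jacobi rule is exact on polynomials of degree less than `2 k`. -/
theorem sum_gaussWeight_mul_eval {α : ℝ} (hα0 : 0 < α) (hα1 : α < 1) {k : ℕ} {p : ℝ[X]} (hp : p.natDegree < 2 * k) :
    ∑ ϑ ∈ gaussNodes α k, gaussWeight α k ϑ * p.eval ϑ = jacobiFunctional hα0 hα1 p := by
  set P := jacobiPoly (-α) (α - 1) k with hPdef
  have hP : P ≠ 0 := jacobiPoly_ne_zero hα1 k
  have hdeg : P.natDegree = k := natDegree_jacobiPoly hα0 hα1 k
  have hk : 0 < k := by omega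
  have hdiv : P * (p / P) + p % P = p := EuclideanDomain.div_add_mod p P
  have hq : (p / P).degree < k := by
    by_cases h0 : p / P = 0
    · rw [h0, degree_zero]; exact WithBot.bot_lt_coe k
    · have h1 := natDegree_sub_le p (p % P)
      rw [← eq_sub_of_add_eq hdiv, natDegree_mul hP h0, hdeg] at h1
      have h2 := natDegree_mod_lt p (q := P) (by omega)
      refine (natDegree_lt_iff_degree_lt h0).1 ?_
      omega
  have hr : (p % P).degree < (gaussNodes α k).card := by
    rw [card_gaussNodes hα0 hα1]
    have := EuclideanDomain.mod_lt p hP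
    exact this.trans_le (by rw [degree_eq_natDegree hP, hdeg])
  have hJ : jacobiFunctional hα0 hα1 p = jacobiFunctional hα0 hα1 (p % P) := by
    conv_lhs => rw [← hdiv, map_add, jacobiFunctional_jacobiPoly_mul hα0 hα1 hq, zero_add]
  have heval : ∀ ϑ ∈ gaussNodes α k, p.eval ϑ = (p % P).eval ϑ := by
    intro ϑ hϑ
    conv_lhs => rw [← hdiv, eval_add, eval_mul, (mem_gaussNodes hα1).1 hϑ, zero_mul, zero_add]
  rw [hJ, Lagrange.eq_interpolate (v := id) Function.injective_id.injOn hr,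
    Lagrange.interpolate_apply, map_sum]
  refine Finset.sum_congr rfl fun ϑ hϑ => ?_
  rw [heval ϑ hϑ, ← smul_eq_C_mul, map_smul, smul_eq_mul, gaussWeight_eq hα0 hα1, mul_comm, id]

/-- A weight equals the integral of the square of its Lagrange basis polynomial. -/
theorem gaussWeight_nonneg {α : ℝ} (hα0 : 0 < α) (hα1 : α < 1) {k : ℕ} {ϑ : ℝ} (hϑ : ϑ ∈ gaussNodes α k) : 0 ≤ gaussWeight α k ϑ := by
  set ℓ := Lagrange.basis (gaussNodes α k) id ϑ with hℓ
  have hcard := card_gaussNodes hα0 hα1 k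
  have hk : 0 < k := by rw [← hcard]; exact Finset.card_pos.2 ⟨ϑ, hϑ⟩
  have hdeg : (ℓ ^ 2).natDegree < 2 * k := by
    rw [natDegree_pow, Lagrange.natDegree_basis Function.injective_id.injOn hϑ, hcard]; omega
  have h1 := sum_gaussWeight_mul_eval hα0 hα1 hdeg
  have h2 : gaussWeight α k ϑ = ∑ x ∈ gaussNodes α k, gaussWeight α k x * (ℓ ^ 2).eval x := by
    rw [Finset.sum_eq_single ϑ]
    · have : ℓ.eval ϑ = 1 := Lagrange.eval_basis_self (v := id) Function.injective_id.injOn hϑ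
      rw [eval_pow, this, one_pow, mul_one]
    · intro x hx hne
      have : ℓ.eval x = 0 := Lagrange.eval_basis_of_ne (v := id) hne.symm hx
      rw [eval_pow, this]; simp
    · exact fun h => absurd hϑ h
  rw [h2, h1]
  exact jacobiFunctional_nonneg hα0 hα1 fun t _ => by rw [eval_pow]; positivity

/-- The error of the Gauss-Jacobi rule is controlled by uniform polynomial approximation of the integrand. -/
theorem abs_integral_sub_sum_gaussWeight_le {α : ℝ} (hα0 : 0 < α) (hα1 : α < 1) {k : ℕ} {f : ℝ → ℝ} {p : ℝ[X]} {ε : ℝ}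
    (hf : IntegrableOn (fun t => f t * jacobiWeight α t) (Ioo (-1) 1))
    (hp : p.natDegree < 2 * k) (hε : ∀ t ∈ Ioo (-1 : ℝ) 1, |f t - p.eval t| ≤ ε) :
    |(∫ t in Ioo (-1 : ℝ) 1, f t * jacobiWeight α t) -
        ∑ ϑ ∈ gaussNodes α k, gaussWeight α k ϑ * f ϑ| ≤
      2 * ε * (Real.pi / Real.sin (α * Real.pi)) := by
  have hmass := integral_jacobiWeight hα0 hα1
  have hexact := sum_gaussWeight_mul_eval hα0 hα1 hp
  have hsum : ∑ ϑ ∈ gaussNodes α k, gaussWeight α k ϑ = Real.pi / Real.sin (α * Real.pi) := by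
    have := sum_gaussWeight_mul_eval hα0 hα1 (k := k) (p := 1) (by rw [natDegree_one]; omega)
    rw [jacobiFunctional_apply] at this
    simpa [hmass] using this
  have h1 : |(∫ t in Ioo (-1 : ℝ) 1, f t * jacobiWeight α t) - jacobiFunctional hα0 hα1 p| ≤
      ε * (Real.pi / Real.sin (α * Real.pi)) := by
    rw [jacobiFunctional_apply,
      ← integral_sub hf (integrableOn_eval_mul_jacobiWeight hα0 hα1 p), ← hmass,
      ← integral_const_mul, ← Real.norm_eq_abs]
    refine norm_integral_le_of_norm_le ((integrableOn_jacobiWeight hα0 hα1).const_mul ε) ?_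
    rw [ae_restrict_iff' measurableSet_Ioo]
    refine Filter.Eventually.of_forall fun t ht => ?_
    rw [← sub_mul, norm_mul, Real.norm_eq_abs, Real.norm_of_nonneg (jacobiWeight_pos ht).le]
    exact mul_le_mul_of_nonneg_right (hε t ht) (jacobiWeight_pos ht).le
  have h2 : |jacobiFunctional hα0 hα1 p - ∑ ϑ ∈ gaussNodes α k, gaussWeight α k ϑ * f ϑ| ≤
      ε * (Real.pi / Real.sin (α * Real.pi)) := by
    rw [← hexact, ← Finset.sum_sub_distrib, ← hsum, Finset.mul_sum]
    refine (Finset.abs_sum_le_sum_abs _ _).trans (Finset.sum_le_sum fun ϑ hϑ => ?_)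
    have hw := gaussWeight_nonneg hα0 hα1 hϑ
    rw [← mul_sub, abs_mul, abs_of_nonneg hw, abs_sub_comm, mul_comm]
    exact mul_le_mul_of_nonneg_right (hε ϑ (gaussNodes_subset hα0 hα1 k hϑ)) hw
  have h3 := abs_sub_le (∫ t in Ioo (-1 : ℝ) 1, f t * jacobiWeight α t)
    (jacobiFunctional hα0 hα1 p) (∑ ϑ ∈ gaussNodes α k, gaussWeight α k ϑ * f ϑ)
  linarith

/-! ### Chebyshev approximation and the scalar error -/

theorem eval_T_half_add_inv {y : ℝ} (hy : y ≠ 0) (n : ℕ) :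
    (Chebyshev.T ℝ n).eval ((y + y⁻¹) / 2) = (y ^ n + (y⁻¹) ^ n) / 2 := by
  induction n using Nat.twoStepInduction with
  | zero => simp
  | one => simp
  | more n ih0 ih1 =>
    have h := Chebyshev.T_add_two ℝ n
    push_cast at ih0 ih1 ⊢
    rw [h, eval_sub, eval_mul, eval_mul, eval_X, eval_ofNat, ih0, ih1]
    linear_combination (y ^ n + y⁻¹ ^ n) / 2 * mul_inv_cancel₀ hy

/-- For `f(t) = 1 / (b² (1 - t) + a² (1 + t))` with pole `t₀`, the identity `f(t) - p(t) = f(t) T_{2k}(t) / T_{2k}(t₀)`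
defines a polynomial `p` of degree less than `2 k`, and `T_{2k}(t₀) ≥ ρ^(-2k) / 2` with `ρ = (a - b) / (a + b)`. -/
theorem exists_polynomial_approx_inv {a b m : ℝ} (ha : 0 < a) (hb : 0 < b) (hm : 0 < m)
    (hma : m ≤ a ^ 2) (hmb : m ≤ b ^ 2) {k : ℕ} (hk : 1 ≤ k) :
    ∃ p : ℝ[X], p.natDegree < 2 * k ∧ ∀ t ∈ Ioo (-1 : ℝ) 1,
      |(b ^ 2 * (1 - t) + a ^ 2 * (1 + t))⁻¹ - p.eval t| ≤ ((a - b) / (a + b)) ^ (2 * k) / m := by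
  rcases eq_or_ne a b with rfl | hab
  · refine ⟨C (2 * a ^ 2)⁻¹, by rw [natDegree_C]; omega, fun t _ => ?_⟩
    rw [eval_C, ← mul_add, show (1 - t + (1 + t) : ℝ) = 2 by ring, mul_comm, sub_self, abs_zero,
      sub_self, zero_div, zero_pow (by omega), zero_div]
  have hab1 : a - b ≠ 0 := sub_ne_zero.2 hab
  have hab2 : a + b ≠ 0 := by positivity
  set y : ℝ := -((a + b) / (a - b)) with hy
  have hy0 : y ≠ 0 := neg_ne_zero.2 (div_ne_zero hab2 hab1)
  set t₀ : ℝ := (y + y⁻¹) / 2 with ht₀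
  have hd : a ^ 2 - b ^ 2 ≠ 0 := by
    rw [sq_sub_sq]; exact mul_ne_zero hab2 hab1
  have hpole : ∀ t : ℝ, b ^ 2 * (1 - t) + a ^ 2 * (1 + t) = (a ^ 2 - b ^ 2) * (t - t₀) := by
    intro t
    rw [ht₀, hy]
    field_simp
    ring
  set T := Chebyshev.T ℝ ((2 * k : ℕ) : ℤ) with hT
  set T₀ : ℝ := T.eval t₀ with hT₀
  have hT₀_eq : T₀ = (y ^ (2 * k) + (y⁻¹) ^ (2 * k)) / 2 := eval_T_half_add_inv hy0 _
  have hy1 : 0 < y ^ (2 * k) := (even_two_mul k).pow_pos hy0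
  have hy2 : 0 < (y⁻¹) ^ (2 * k) := (even_two_mul k).pow_pos (inv_ne_zero hy0)
  have hT₀pos : 0 < T₀ := by rw [hT₀_eq]; positivity
  have hρ : ((a - b) / (a + b)) ^ (2 * k) = (y ^ (2 * k))⁻¹ := by
    rw [hy, (even_two_mul k).neg_pow, ← inv_pow, inv_div]
  obtain ⟨q, hq⟩ : (X - C t₀) ∣ C T₀ - T := dvd_iff_isRoot.2 (by simp [hT₀])
  have hqdeg : q.natDegree < 2 * k := by
    rcases eq_or_ne q 0 with rfl | hq0
    · rw [natDegree_zero]; omega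
    · have h1 := natDegree_sub_le (C T₀) T
      rw [hq, natDegree_mul (X_sub_C_ne_zero t₀) hq0, natDegree_X_sub_C, natDegree_C, hT,
        Chebyshev.natDegree_T, Int.natAbs_natCast] at h1
      omega
  refine ⟨C (T₀ * (a ^ 2 - b ^ 2))⁻¹ * q, (natDegree_C_mul_le _ _).trans_lt hqdeg, fun t ht => ?_⟩
  have h1 : 0 < 1 - t := by linarith [ht.2]
  have h2 : 0 < 1 + t := by linarith [ht.1]
  have hD : 2 * m ≤ b ^ 2 * (1 - t) + a ^ 2 * (1 + t) := by
    nlinarith [mul_nonneg (sub_nonneg.2 hmb) h1.le, mul_nonneg (sub_nonneg.2 hma) h2.le]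
  have htt : t - t₀ ≠ 0 := by
    intro h0
    have := hpole t
    rw [h0, mul_zero] at this
    linarith
  have hqt : q.eval t = (T₀ - T.eval t) / (t - t₀) := by
    rw [eq_div_iff htt]
    have := congrArg (Polynomial.eval t) hq
    simp only [eval_sub, eval_mul, eval_X, eval_C] at this
    linarith
  have hdiff : (b ^ 2 * (1 - t) + a ^ 2 * (1 + t))⁻¹ - (C (T₀ * (a ^ 2 - b ^ 2))⁻¹ * q).eval t =
      (b ^ 2 * (1 - t) + a ^ 2 * (1 + t))⁻¹ * (T.eval t / T₀) := by
    rw [eval_mul, eval_C, hqt, hpole]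
    have := hT₀pos.ne'
    field_simp
    ring
  have hTt : |T.eval t| ≤ 1 :=
    Chebyshev.abs_eval_T_real_le_one _ (abs_le.2 ⟨ht.1.le, ht.2.le⟩)
  rw [hdiff, abs_mul, abs_div, abs_of_pos hT₀pos, abs_of_pos (inv_pos.2 (by linarith)), hρ]
  have hT₀ge : y ^ (2 * k) / 2 ≤ T₀ := by rw [hT₀_eq]; linarith
  calc (b ^ 2 * (1 - t) + a ^ 2 * (1 + t))⁻¹ * (|T.eval t| / T₀)
      ≤ (2 * m)⁻¹ * (1 / (y ^ (2 * k) / 2)) := by gcongr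
    _ = (y ^ (2 * k))⁻¹ / m := by field_simp

/-- The value at `l` of the scalar rational function `τ^(-α) R_{k-1,k}(· / τ)`. -/
def scalarApprox (α : ℝ) (k : ℕ) (τ l : ℝ) : ℝ :=
  ∑ ϑ ∈ gaussNodes α k,
    2 * Real.sin (α * Real.pi) * τ ^ (1 - α) / Real.pi * (gaussWeight α k ϑ / (1 + ϑ)) *
      (τ * (1 - ϑ) / (1 + ϑ) + l)⁻¹

theorem sin_mul_pi_pos {α : ℝ} (hα0 : 0 < α) (hα1 : α < 1) : 0 < Real.sin (α * Real.pi) :=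
  Real.sin_pos_of_pos_of_lt_pi (by positivity) (by nlinarith [Real.pi_pos])

theorem abs_rpow_sub_scalarApprox_le {α : ℝ} (hα0 : 0 < α) (hα1 : α < 1) {l τ m : ℝ} (hm : 0 < m)
    (hml : m ≤ l) (hmτ : m ≤ τ) {k : ℕ} (hk : 1 ≤ k) :
    |l ^ (-α) - scalarApprox α k τ l| ≤
      4 * τ ^ (1 - α) / m * ((√l - √τ) / (√l + √τ)) ^ (2 * k) := by
  have hl : 0 < l := hm.trans_le hml
  have hτ : 0 < τ := hm.trans_le hmτ
  have hs := sin_mul_pi_pos hα0 hα1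
  have hpi := Real.pi_pos
  obtain ⟨hint, hrep⟩ := integral_jacobiWeight_div hα0 hα1 hl hτ
  obtain ⟨p, hp, hε⟩ := exists_polynomial_approx_inv (Real.sqrt_pos.2 hl) (Real.sqrt_pos.2 hτ) hm
    (by rwa [Real.sq_sqrt hl.le]) (by rwa [Real.sq_sqrt hτ.le]) hk
  rw [Real.sq_sqrt hl.le, Real.sq_sqrt hτ.le] at hε
  have herr := abs_integral_sub_sum_gaussWeight_le hα0 hα1 hint hp hε
  have happ : scalarApprox α k τ l = 2 * Real.sin (α * Real.pi) * τ ^ (1 - α) / Real.pi *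
      ∑ ϑ ∈ gaussNodes α k, gaussWeight α k ϑ * (τ * (1 - ϑ) + l * (1 + ϑ))⁻¹ := by
    rw [scalarApprox, Finset.mul_sum]
    refine Finset.sum_congr rfl fun ϑ hϑ => ?_
    have hϑ' := gaussNodes_subset hα0 hα1 k hϑ
    have h1 : 0 < 1 - ϑ := by linarith [hϑ'.2]
    have h2 : 0 < 1 + ϑ := by linarith [hϑ'.1]
    have h3 : τ * (1 - ϑ) + l * (1 + ϑ) ≠ 0 := by positivity
    rw [mul_assoc]
    congr 1
    field_simp
  rw [happ, ← hrep, ← mul_sub, abs_mul, abs_of_pos (by positivity)]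
  refine (mul_le_mul_of_nonneg_left herr (by positivity)).trans_eq ?_
  field_simp
  ring

/-- The fundamental estimate behind the linearized choice of `τ_k`; the cubic term is what absorbs constant factors. -/
theorem one_sub_div_one_add_le_exp {y : ℝ} (h0 : 0 ≤ y) (h1 : y ≤ 1) :
    (1 - y) / (1 + y) ≤ Real.exp (-(2 * y + 2 / 3 * y ^ 3)) := by
  rcases h1.eq_or_lt with rfl | h1
  · rw [sub_self, zero_div]; positivity
  have hsum := Real.hasSum_log_sub_log_of_abs_lt_one (abs_lt.2 ⟨by linarith, h1⟩)
  have hle := sum_le_hasSum (Finset.range 2) (fun i _ => by positivity) hsum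
  simp only [Finset.sum_range_succ, Finset.sum_range_zero] at hle
  norm_num at hle
  have ha : 0 < 1 - y := by linarith
  have hb : 0 < 1 + y := by linarith
  rw [← Real.exp_log (div_pos ha hb), Real.exp_le_exp, Real.log_div ha.ne' hb.ne']
  linarith

/-! ### Reduction to the spectrum -/

theorem opNorm_le_of_apply_orthonormalBasis {𝕜 E ι : Type*} [RCLike 𝕜] [NormedAddCommGroup E]
    [InnerProductSpace 𝕜 E] [Fintype ι] (b : OrthonormalBasis ι 𝕜 E) (A : E →L[𝕜] E) (d : ι → 𝕜)
    (hA : ∀ i, A (b i) = d i • b i) {M : ℝ} (hM : 0 ≤ M) (hd : ∀ i, ‖d i‖ ≤ M) : ‖A‖ ≤ M := by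
  refine A.opNorm_le_bound hM fun x => ?_
  have hAx : A x = ∑ i, (b.repr x i * d i) • b i := by
    conv_lhs => rw [← b.sum_repr x, map_sum]
    simp only [map_smul, hA, smul_smul]
  have hcoord : ∀ i, inner 𝕜 (b i) (A x) = b.repr x i * d i := by
    intro i
    rw [hAx]
    exact b.orthonormal.inner_right_fintype _ i
  refine le_of_sq_le_sq ?_ (by positivity)
  rw [mul_pow, ← b.sum_sq_norm_inner_right (A x), ← b.sum_sq_norm_inner_right x, Finset.mul_sum]
  refine Finset.sum_le_sum fun i _ => ?_
  rw [hcoord, norm_mul, mul_pow, mul_comm, b.repr_apply_apply]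
  have := hd i
  gcongr

theorem eigenvalues_mem_of_spectrum_subset {𝕜 E : Type*} [RCLike 𝕜] [NormedAddCommGroup E] [InnerProductSpace 𝕜 E]
    [FiniteDimensional 𝕜 E] {L : E →L[𝕜] E} (hL : (L : E →ₗ[𝕜] E).IsSymmetric)
    {S : Set ℝ} (hspec : spectrum 𝕜 L ⊆ (fun x : ℝ => (x : 𝕜)) '' S)
    (s : Fin (Module.finrank 𝕜 E)) : hL.eigenvalues rfl s ∈ S := by
  have hmem : ((hL.eigenvalues rfl s : ℝ) : 𝕜) ∈ spectrum 𝕜 L := by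
    rw [spectrum.mem_iff]
    rintro ⟨u, hu⟩
    have happ := hL.apply_eigenvectorBasis rfl s
    set v := hL.eigenvectorBasis rfl s with hv
    have hzero : (u : E →L[𝕜] E) v = 0 := by
      rw [hu, _root_.sub_apply, Algebra.algebraMap_eq_smul_one]
      simp only [_root_.smul_apply, one_apply_eq_self]
      exact sub_eq_zero.2 happ.symm
    have hv0 : v = 0 := by
      have h1 : ((↑u⁻¹ : E →L[𝕜] E) * u) v = v := by rw [u.inv_mul, one_apply_eq_self]
      rw [mul_apply_eq_comp, hzero, map_zero] at h1
      exact h1.symm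
    have hnorm : ‖v‖ = 1 := (hL.eigenvectorBasis rfl).orthonormal.1 s
    rw [hv0, norm_zero] at hnorm
    exact zero_ne_one hnorm
  obtain ⟨x, hx, hxe⟩ := hspec hmem
  rw [RCLike.ofReal_inj] at hxe
  rwa [← hxe]

theorem negPow_apply_eigenvectorBasis {𝕜 E : Type*} [RCLike 𝕜] [NormedAddCommGroup E] [InnerProductSpace 𝕜 E]
    [FiniteDimensional 𝕜 E] (L : E →L[𝕜] E) (hL : (L : E →ₗ[𝕜] E).IsSymmetric) (α : ℝ)
    (s : Fin (Module.finrank 𝕜 E)) :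
    negPow L hL α (hL.eigenvectorBasis rfl s) =
      (((hL.eigenvalues rfl s) ^ (-α) : ℝ) : 𝕜) • hL.eigenvectorBasis rfl s := by
  rw [negPow, _root_.sum_apply, Finset.sum_eq_single s]
  · simp
  · intro i _ hi
    have := (hL.eigenvectorBasis rfl).orthonormal.2 hi
    simp [this]
  · simp

theorem inverse_smul_one_add_apply {𝕜 E : Type*} [RCLike 𝕜] [NormedAddCommGroup E] [InnerProductSpace 𝕜 E]
    {L : E →L[𝕜] E} {S : Set ℝ}
    (hspec : spectrum 𝕜 L ⊆ (fun x : ℝ => (x : 𝕜)) '' S) {η μ : ℝ} (hη : -η ∉ S)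
    (hμ : η + μ ≠ 0) {v : E} (hv : L v = (μ : 𝕜) • v) :
    Ring.inverse ((η : 𝕜) • (1 : E →L[𝕜] E) + L) v = (((η + μ)⁻¹ : ℝ) : 𝕜) • v := by
  have hunit : IsUnit ((η : 𝕜) • (1 : E →L[𝕜] E) + L) := by
    have hnot : ((-η : ℝ) : 𝕜) ∉ spectrum 𝕜 L := by
      intro h
      obtain ⟨x, hx, hxe⟩ := hspec h
      rw [RCLike.ofReal_inj] at hxe
      exact hη (hxe ▸ hx)
    rw [spectrum.notMem_iff, Algebra.algebraMap_eq_smul_one] at hnot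
    have := hnot.neg
    rwa [neg_sub, RCLike.ofReal_neg, neg_smul, sub_neg_eq_add, add_comm] at this
  have happ : ((η : 𝕜) • (1 : E →L[𝕜] E) + L) v = ((η + μ : ℝ) : 𝕜) • v := by
    simp [hv, add_smul]
  have hinv := congrArg (fun B : E →L[𝕜] E => B v) (Ring.inverse_mul_cancel _ hunit)
  simp only [mul_apply_eq_comp, happ, map_smul, one_apply_eq_self] at hinv
  have hμ' : ((η + μ : ℝ) : 𝕜) ≠ 0 := by exact_mod_cast hμ
  rw [RCLike.ofReal_inv, ← hinv, smul_smul, inv_mul_cancel₀ hμ', one_smul, hinv]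

/-- By the spectral theorem the operator error is the largest scalar error on the spectrum. -/
theorem norm_negPow_sub_ratApprox_le {𝕜 E : Type*} [RCLike 𝕜] [NormedAddCommGroup E] [InnerProductSpace 𝕜 E]
    [FiniteDimensional 𝕜 E] {α : ℝ} (hα0 : 0 < α) (hα1 : α < 1) {c lam τ : ℝ} (hc : 0 < c)
    (hτ : 0 < τ) (L : E →L[𝕜] E) (hL : (L : E →ₗ[𝕜] E).IsSymmetric)
    (hspec : spectrum 𝕜 L ⊆ (fun x : ℝ => (x : 𝕜)) '' Set.Icc c lam) (k : ℕ) {M : ℝ} (hM : 0 ≤ M)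
    (h : ∀ l ∈ Set.Icc c lam, |l ^ (-α) - scalarApprox α k τ l| ≤ M) :
    ‖negPow L hL α - ((τ ^ (-α) : ℝ) : 𝕜) • ratApprox α k (((τ⁻¹ : ℝ) : 𝕜) • L)‖ ≤ M := by
  refine opNorm_le_of_apply_orthonormalBasis (hL.eigenvectorBasis rfl) _
    (fun s => (((hL.eigenvalues rfl s) ^ (-α) - scalarApprox α k τ (hL.eigenvalues rfl s) : ℝ) : 𝕜))
    (fun s => ?_) hM fun s => ?_
  · have hμ := eigenvalues_mem_of_spectrum_subset hL hspec s
    have happ := hL.apply_eigenvectorBasis rfl s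
    rw [smul_ratApprox_eq α k hτ, _root_.sub_apply, negPow_apply_eigenvectorBasis,
      RCLike.ofReal_sub, sub_smul, _root_.sum_apply, scalarApprox,
      RCLike.ofReal_sum, Finset.sum_smul]
    congr 1
    refine Finset.sum_congr rfl fun ϑ hϑ => ?_
    have hϑ' := gaussNodes_subset hα0 hα1 k hϑ
    have h1 : 0 < 1 - ϑ := by linarith [hϑ'.2]
    have h2 : 0 < 1 + ϑ := by linarith [hϑ'.1]
    have hη : 0 < τ * (1 - ϑ) / (1 + ϑ) := by positivity
    rw [_root_.smul_apply,
      inverse_smul_one_add_apply hspec (fun hmem => by linarith [hmem.1]) (by linarith [hμ.1]) happ,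
      smul_smul, ← RCLike.ofReal_mul]
  · rw [RCLike.norm_ofReal]
    exact h _ (eigenvalues_mem_of_spectrum_subset hL hspec s)

/-! ### The choice of the parameter -/

/-- `√τ_k` is the positive root `s` of a quadratic equation, and it is bounded below uniformly in `k`. -/
theorem exists_tauK_eq_sq {α c lam : ℝ} (hα0 : 0 < α) (hc : 0 < c) (hclam : c ≤ lam) :
    ∃ s₀ : ℝ, 0 < s₀ ∧ ∀ k : ℕ, 1 ≤ k → ∃ s : ℝ, s₀ ≤ s ∧ s ≤ √lam ∧ tauK α c lam k = s ^ 2 ∧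
      s ^ 2 + α * √lam / (4 * k) * Real.log (lam / c) * s = √c * √lam := by
  have hlam : 0 < lam := hc.trans_le hclam
  have hlog : 0 ≤ Real.log (lam / c) := Real.log_nonneg ((one_le_div hc).2 hclam)
  set A : ℝ := α * √lam / 8 * Real.log (lam / c) with hA
  have hA0 : 0 ≤ A := by positivity
  have hsl : 0 < √lam := Real.sqrt_pos.2 hlam
  have hsc : 0 < √c := Real.sqrt_pos.2 hc
  have hcl : √c ≤ √lam := Real.sqrt_le_sqrt hclam
  -- With `δ = A / k` the equation reads `s (s + 2 δ) = √c √lam`, where `s + 2 δ ≤ √lam + 2 A`.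
  refine ⟨√c * √lam / (√lam + 2 * A), by positivity, fun k hk => ?_⟩
  have hk1 : (1 : ℝ) ≤ k := by exact_mod_cast hk
  have hk0 : (0 : ℝ) < k := by linarith
  set δ : ℝ := α * √lam / (8 * k) * Real.log (lam / c) with hδ
  have hδA : δ * k = A := by rw [hδ, hA]; field_simp
  have hδ0 : 0 ≤ δ := by positivity
  have hδle : δ ≤ A := by nlinarith
  set r : ℝ := √(δ ^ 2 + √(c * lam)) with hr
  have hG : √(c * lam) = √c * √lam := Real.sqrt_mul hc.le lam
  have hGpos : 0 < √c * √lam := by positivity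
  have hr2 : r ^ 2 = δ ^ 2 + √c * √lam := by rw [hr, Real.sq_sqrt (by positivity), hG]
  have hr0 : 0 ≤ r := Real.sqrt_nonneg _
  have hs0 : 0 < -δ + r := by nlinarith
  have hquad : (-δ + r) ^ 2 + 2 * δ * (-δ + r) = √c * √lam := by linear_combination hr2
  have hsle : -δ + r ≤ √lam := by
    refine le_of_sq_le_sq ?_ hsl.le
    nlinarith [mul_nonneg hδ0 hs0.le]
  refine ⟨-δ + r, ?_, hsle, rfl, ?_⟩
  · rw [div_le_iff₀ (by positivity)]
    nlinarith
  · rw [← hquad, show α * √lam / (4 * k) * Real.log (lam / c) = 2 * δ by rw [hδ]; ring]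

/-- The choice of `τ = s²` makes the two exponents at the ends of the spectrum equal, hence equal to their mean, which the
inequality of arithmetic and geometric means bounds. -/
theorem exponent_le_of_quadratic {α c lam s k : ℝ} (hc : 0 < c) (hlam : 0 < lam) (hs : 0 < s)
    (hk : 0 < k) (hquad : s ^ 2 + α * √lam / (4 * k) * Real.log (lam / c) * s = √c * √lam) :
    c ^ (-α) * Real.exp (-(4 * k * (√c / s))) ≤
        (c * lam) ^ (-α / 2) * Real.exp (-4 * k * (c / lam) ^ (1 / 4 : ℝ)) ∧
      lam ^ (-α) * Real.exp (-(4 * k * (s / √lam))) ≤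
        (c * lam) ^ (-α / 2) * Real.exp (-4 * k * (c / lam) ^ (1 / 4 : ℝ)) := by
  have hsl : 0 < √lam := Real.sqrt_pos.2 hlam
  have hsc : 0 < √c := Real.sqrt_pos.2 hc
  set q : ℝ := (c / lam) ^ (1 / 4 : ℝ) with hq
  have hq0 : 0 < q := by positivity
  have hq2 : q ^ 2 = (√c / s) * (s / √lam) := by
    rw [hq, ← Real.rpow_natCast, ← Real.rpow_mul (by positivity),
      show (1 / 4 : ℝ) * (2 : ℕ) = 1 / 2 by norm_num, ← Real.sqrt_eq_rpow, Real.sqrt_div hc.le]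
    field_simp
  have hamgm : 2 * q ≤ √c / s + s / √lam := by
    refine le_of_sq_le_sq ?_ (by positivity)
    nlinarith [sq_nonneg (√c / s - s / √lam)]
  have hequal : α * (Real.log lam - Real.log c) = 4 * k * (√c / s - s / √lam) := by
    rw [Real.log_div hlam.ne' hc.ne'] at hquad
    field_simp at hquad ⊢
    linear_combination hquad
  have hkq := mul_le_mul_of_nonneg_left hamgm hk.le
  rw [Real.rpow_def_of_pos hc, Real.rpow_def_of_pos hlam, Real.rpow_def_of_pos (mul_pos hc hlam),
    Real.log_mul hc.ne' hlam.ne', ← Real.exp_add, ← Real.exp_add, ← Real.exp_add,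
    Real.exp_le_exp, Real.exp_le_exp]
  constructor <;> linarith

theorem pow_le_exp_of_le_one_sub_div {x y y₀ : ℝ} (hy0 : 0 ≤ y₀) (hy : y₀ ≤ y) (hy1 : y ≤ 1) (hx0 : 0 ≤ x)
    (hx : x ≤ (1 - y) / (1 + y)) (k : ℕ) :
    x ^ (2 * k) ≤ Real.exp (-(4 * k * y)) * Real.exp (-(4 / 3 * k * y₀ ^ 3)) := by
  calc x ^ (2 * k) ≤ Real.exp (-(2 * y + 2 / 3 * y ^ 3)) ^ (2 * k) :=
        pow_le_pow_left₀ hx0 (hx.trans (one_sub_div_one_add_le_exp (hy0.trans hy) hy1)) _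
    _ = Real.exp (-(4 * k * y)) * Real.exp (-(4 / 3 * k * y ^ 3)) := by
        rw [← Real.exp_nat_mul, ← Real.exp_add]
        congr 1
        push_cast
        ring
    _ ≤ _ := by gcongr

theorem sub_div_add_le_sub_div_add {u v w : ℝ} (hu : 0 < u) (hw : 0 < w) (huv : u ≤ v) :
    (w - v) / (w + v) ≤ (w - u) / (w + u) := by
  rw [div_le_div_iff₀ (by linarith) (by linarith)]
  nlinarith

/-- On either side of `s²` the factor `((√l - s) / (√l + s))^(2k)` is largest at the end of `[c, lam]`; there it is bounded by the claimed
rate, with an exponentially small factor to spare. -/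
theorem convergence_factor_le {α c lam s s₀ l : ℝ} (hα0 : 0 < α) (hc : 0 < c) (hclam : c ≤ lam)
    (hs₀ : 0 < s₀) (hs : s₀ ≤ s) (hsl : s ≤ √lam) {k : ℕ} (hk : 1 ≤ k)
    (hquad : s ^ 2 + α * √lam / (4 * k) * Real.log (lam / c) * s = √c * √lam)
    (hl : l ∈ Set.Icc c lam) :
    ((√l - s) / (√l + s)) ^ (2 * k) ≤
      lam ^ α * ((c * lam) ^ (-α / 2) * Real.exp (-4 * k * (c / lam) ^ (1 / 4 : ℝ))) *
        Real.exp (-(4 / 3 * k * (min √c s₀ / √lam) ^ 3)) := by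
  have hlam : 0 < lam := hc.trans_le hclam
  have hspos : 0 < s := hs₀.trans_le hs
  have hk0 : (0 : ℝ) < k := by exact_mod_cast hk
  have hslam : 0 < √lam := Real.sqrt_pos.2 hlam
  have hsc : 0 < √c := Real.sqrt_pos.2 hc
  have hcl : √c ≤ √l := Real.sqrt_le_sqrt hl.1
  have hll : √l ≤ √lam := Real.sqrt_le_sqrt hl.2
  have hslpos : 0 < √l := hsc.trans_le hcl
  have hmin : 0 < min √c s₀ := lt_min hsc hs₀
  obtain ⟨hB1, hB2⟩ := exponent_le_of_quadratic hc hlam hspos hk0 hquad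
  rcases le_total √l s with h | h
  · have hcs : √c ≤ s := hcl.trans h
    have hρ : (s - √l) / (s + √l) ≤ (1 - √c / s) / (1 + √c / s) := by
      refine (sub_div_add_le_sub_div_add hsc hspos hcl).trans_eq ?_
      field_simp
    have hy : min √c s₀ / √lam ≤ √c / s :=
      div_le_div₀ hsc.le (min_le_left _ _) hspos hsl
    have hpow := pow_le_exp_of_le_one_sub_div (by positivity) hy ((div_le_one hspos).2 hcs)
      (div_nonneg (sub_nonneg.2 h) (by positivity)) hρ k
    have hX : Real.exp (-(4 * k * (√c / s))) ≤
        lam ^ α * ((c * lam) ^ (-α / 2) * Real.exp (-4 * k * (c / lam) ^ (1 / 4 : ℝ))) := by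
      rw [Real.rpow_neg hc.le, inv_mul_le_iff₀ (by positivity)] at hB1
      refine hB1.trans ?_
      gcongr
    calc ((√l - s) / (√l + s)) ^ (2 * k) = ((s - √l) / (s + √l)) ^ (2 * k) := by
          rw [← (even_two_mul k).neg_pow ((√l - s) / (√l + s)), ← neg_div, neg_sub, add_comm s]
      _ ≤ _ := hpow.trans (by gcongr)
  · have hρ : (√l - s) / (√l + s) ≤ (1 - s / √lam) / (1 + s / √lam) := by
      have h1 : (√l - s) / (√l + s) ≤ (√lam - s) / (√lam + s) := by
        rw [div_le_div_iff₀ (by positivity) (by positivity)]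
        nlinarith
      refine h1.trans_eq ?_
      field_simp
    have hy : min √c s₀ / √lam ≤ s / √lam := by
      gcongr
      exact (min_le_right _ _).trans hs
    have hpow := pow_le_exp_of_le_one_sub_div (by positivity) hy ((div_le_one hslam).2 hsl)
      (div_nonneg (sub_nonneg.2 h) (by positivity)) hρ k
    rw [Real.rpow_neg hlam.le, inv_mul_le_iff₀ (by positivity)] at hB2
    exact hpow.trans (by gcongr)

end FracPow

end

theorem mainTheorem3 (α : ℝ) (hα0 : 0 < α) (hα1 : α < 1) (c lam : ℝ) (hc : 0 < c) (hclam : c ≤ lam) :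
    ∃ C : ℝ, ∀ kbar : ℕ, 1 ≤ kbar →
      (∀ k : ℕ, kbar ≤ k → lam < FracPow.lamBar α k (FracPow.tauK α c lam k)) →
      ∀ (𝕜 : Type*) [RCLike 𝕜] (E : Type*) [NormedAddCommGroup E] [InnerProductSpace 𝕜 E]
        [FiniteDimensional 𝕜 E] (L : E →L[𝕜] E) (hL : (L : E →ₗ[𝕜] E).IsSymmetric),
        spectrum 𝕜 L ⊆ (fun x : ℝ => (x : 𝕜)) '' Set.Icc c lam →
        ∀ k : ℕ, kbar ≤ k →
          ‖FracPow.negPow L hL α -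
              (((FracPow.tauK α c lam k) ^ (-α) : ℝ) : 𝕜) •
                FracPow.ratApprox α k ((((FracPow.tauK α c lam k)⁻¹ : ℝ) : 𝕜) • L)‖ ≤
            2 * Real.sin (α * Real.pi) * (c * lam) ^ (-α / 2) *
              Real.exp (-4 * k * (c / lam) ^ (1 / 4 : ℝ)) * (1 + C / k) := by
  have hlam : 0 < lam := hc.trans_le hclam
  have hsc : 0 < √c := Real.sqrt_pos.2 hc
  have hslam : 0 < √lam := Real.sqrt_pos.2 hlam
  have hsin := FracPow.sin_mul_pi_pos hα0 hα1
  obtain ⟨s₀, hs₀, hτ⟩ := FracPow.exists_tauK_eq_sq hα0 hc hclam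
  set m : ℝ := min c (s₀ ^ 2) with hm
  have hmpos : 0 < m := lt_min hc (by positivity)
  -- `e` is the exponential rate to spare, and `K` the product of all factors that do not depend on `k`.
  set e : ℝ := 4 / 3 * (min √c s₀ / √lam) ^ 3 with he
  have hepos : 0 < e := by have := lt_min hsc hs₀; positivity
  set K : ℝ := 4 * lam ^ (1 - α) / m * lam ^ α with hK
  have hKpos : 0 < K := by positivity
  refine ⟨K / (2 * Real.sin (α * Real.pi) * e), ?_⟩
  intro kbar hkbar _ 𝕜 _ E _ _ _ L hL hspec k hk
  have hk1 : 1 ≤ k := hkbar.trans hk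
  have hk0 : (0 : ℝ) < k := by exact_mod_cast hk1
  obtain ⟨s, hs, hsl, hτs, hquad⟩ := hτ k hk1
  have hspos : 0 < s := hs₀.trans_le hs
  rw [hτs]
  set B : ℝ := (c * lam) ^ (-α / 2) * Real.exp (-4 * k * (c / lam) ^ (1 / 4 : ℝ)) with hB
  have hBpos : 0 < B := by positivity
  have hslam2 : s ^ 2 ≤ lam := by
    rw [← Real.sq_sqrt hlam.le]; gcongr
  have hscalar : ∀ l ∈ Set.Icc c lam,
      |l ^ (-α) - FracPow.scalarApprox α k (s ^ 2) l| ≤ K * B / (k * e) := by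
    intro l hl
    have h1 := FracPow.abs_rpow_sub_scalarApprox_le hα0 hα1 hmpos ((min_le_left _ _).trans hl.1)
      ((min_le_right c (s₀ ^ 2)).trans (by gcongr : s₀ ^ 2 ≤ s ^ 2)) hk1
    rw [Real.sqrt_sq hspos.le] at h1
    have h2 := FracPow.convergence_factor_le hα0 hc hclam hs₀ hs hsl hk1 hquad hl
    rw [← hB, show 4 / 3 * (k : ℝ) * (min √c s₀ / √lam) ^ 3 = k * e by rw [he]; ring] at h2
    have h3 : Real.exp (-(k * e)) ≤ 1 / (k * e) := by
      rw [Real.exp_neg, one_div]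
      gcongr
      linarith [Real.add_one_le_exp (k * e)]
    have h4 : (s ^ 2) ^ (1 - α) ≤ lam ^ (1 - α) :=
      Real.rpow_le_rpow (by positivity) hslam2 (sub_pos.2 hα1).le
    have h5 : 0 ≤ ((√l - s) / (√l + s)) ^ (2 * k) := (even_two_mul k).pow_nonneg _
    calc |l ^ (-α) - FracPow.scalarApprox α k (s ^ 2) l|
        ≤ 4 * (s ^ 2) ^ (1 - α) / m * ((√l - s) / (√l + s)) ^ (2 * k) := h1
      _ ≤ 4 * lam ^ (1 - α) / m * (lam ^ α * B * (1 / (k * e))) := by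
          gcongr
          exact h2.trans (by gcongr)
      _ = K * B / (k * e) := by rw [hK]; ring
  refine (FracPow.norm_negPow_sub_ratApprox_le hα0 hα1 hc (by positivity) L hL hspec k
    (by positivity) hscalar).trans ?_
  calc K * B / (k * e) = 2 * Real.sin (α * Real.pi) * B *
        (K / (2 * Real.sin (α * Real.pi) * e) / k) := by field_simp
    _ ≤ 2 * Real.sin (α * Real.pi) * B * (1 + K / (2 * Real.sin (α * Real.pi) * e) / k) := by
        gcongr
        linarith
    _ = _ := by rw [hB]; ring
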